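/- Let $F$ be a field of prime characteristic $p$, let $n\ge 0$, and let $G$ be a cyclic group of order $p^n$. Up to isomorphism there is exactly one indecomposable $FG$-module $V_d$ of dimension $d$ for each $1\le d\le p^n$, and there are no other finite-dimensional indecomposable $FG$-modules. Let $1\le r,s\le p^n$ and write $$V_r\otimes V_s\;\cong\;\bigoplus_{i=1}^t m_iV_{\mu_i},\qquad \mu_1>\cdots>\mu_t>0,\quad m_1,\dots,m_t>0,$$ where $G$ acts diagonally on the tensor product and $mV$ denotes the direct sum of $m$ copies of $V$. Then, for given $r$ and $s$, the multiplicities $m_1,\dots,m_t$ determine the part sizes $\mu_1,\dots,\mu_t$, and conversely (independently of $p$, $F$ and $n$), via $$\mu_i=r+s-m_i-2\sum_{j=1}^{i-1}m_j\qquad(1\le i\le t),$$ $$m_i=(-1)^{i-1}\Bigl[r+s+2\sum_{j=1}^{i-1}(-1)^{j}\mu_j\Bigr]-\mu_i\qquad(1\le i\le t).$$ In particular McFall's second conjecture holds: $m_1=r+s-\mu_1$, and $m_i=\mu_{i-1}-\mu_i-m_{i-1}$ for $1<i\le t$. -/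

import Mathlib

universe u v w u' v' w'

/-- A representation is indecomposable if it is nonzero and is not the direct sum of two
nonzero subrepresentations. -/
def Representation.IsIndecomposable {F : Type u} {G : Type v} {V : Type w} [Field F] [Group G]
    [AddCommGroup V] [Module F V] (ρ : Representation F G V) : Prop :=
  Nontrivial V ∧ ∀ W₁ W₂ : Subrepresentation ρ, IsCompl W₁ W₂ → W₁ = ⊥ ∨ W₂ = ⊥

/-- `IsIndecomposableOfDim d V` says that the `F`-linear representation `V` of `G` is
indecomposable of dimension `d`. (For `G` cyclic of order `p ^ n`, `F` of characteristic `p` and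
`1 ≤ d ≤ p ^ n`, this pins down the module `V_d` up to isomorphism.) -/
def IsIndecomposableOfDim {F : Type u} {G : Type v} [Field F] [Group G] (d : ℕ)
    (V : Rep.{w} F G) : Prop :=
  V.ρ.IsIndecomposable ∧ Module.finrank F V = d

/-- `IsGreenDecomposition F G r s m μ` says that
`V_r ⊗ V_s ≅ m₁ V_{μ₁} ⊕ ⋯ ⊕ m_t V_{μ_t}` as `F`-linear representations of `G`
(with the diagonal action on the tensor product), where `μ₁ > ⋯ > μ_t > 0`, all `m_i > 0`, and
`V_d` is an indecomposable representation of dimension `d`. The indices are shifted to start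
from `0`. -/
structure IsGreenDecomposition (F : Type u) (G : Type v) [Field F] [Group G] (r s : ℕ) {t : ℕ}
    (m μ : Fin t → ℕ) : Prop where
  strictAnti : StrictAnti μ
  part_pos : ∀ i, 0 < μ i
  mult_pos : ∀ i, 0 < m i
  iso : ∃ (A B : Rep.{w} F G) (C : Fin t → Rep.{w} F G),
    IsIndecomposableOfDim r A ∧ IsIndecomposableOfDim s B ∧
    (∀ i, IsIndecomposableOfDim (μ i) (C i)) ∧
    Nonempty ((A.ρ.tprod B.ρ).Equiv
      (Representation.directSum fun x : (i : Fin t) × Fin (m i) => (C x.1).ρ))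

/-! Let g generate G. An indecomposable module is a single Jordan block for the nilpotent operator g
- 1, so it is F[X]/(X^d), and the number of parts of size at least k is the rank drop from (g -
1)^(k-1) to (g - 1)^k. On V_r ⊗ V_s the operator g ⊗ g - 1 is an automorphism times a commuting
operator L = 1 ⊗ (g - 1) - (g⁻¹ - 1) ⊗ 1, so powers of L have the same ranks
(`finrank_range_tprod_sub_one_pow`). The gain is homogeneity: L is multiplication by y on F[x, y]/I
with I = (x^r, (y + x)^s) (`exists_tensor_presentation`).

By induction on k, the colon ideal (I : y^k) has two homogeneous generators, of degrees a + b = r +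
s - k. They can be changed to P, yQ with y not dividing P; then (I : y^(k+1)) = (P, Q), and the rank
drop is dim F[x, y]/(P, y) = deg P, which is a or b (`colon_step`). As a is the preceding drop when
k ≥ 1, consecutive drops are equal or add up to r + s - k.

The drops differ exactly at k = μ_i, where they are m_1 + ... + m_i and m_1 + ... + m_(i-1). This
gives the formula for μ_i; the rest is arithmetic. -/

namespace GreenRing

open Polynomial TensorProduct DirectSum

/-! ### Homogeneous ideals of F[x, y] with two generators; x is the inner variable, y the outer one.
-/

section Homogeneous

variable {F : Type*} [Field F]

/-- The bivariate polynomial `P` is homogeneous of degree `d`. -/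
def IsHomog (d : ℕ) (P : F[X][X]) : Prop :=
  ∀ i j, i + j ≠ d → (P.coeff i).coeff j = 0

theorem IsHomog.coeff_zero {d : ℕ} {P : F[X][X]} (hP : IsHomog d P) :
    P.coeff 0 = C ((P.coeff 0).coeff d) * X ^ d := by
  ext j
  rw [coeff_C_mul_X_pow]
  split_ifs with h
  · rw [h]
  · exact hP 0 j (by omega)

theorem IsHomog.divX {d : ℕ} {P : F[X][X]} (hP : IsHomog (d + 1) P) : IsHomog d P.divX := by
  intro i j hij
  rw [coeff_divX]
  exact hP _ _ (by omega)

theorem isHomog_one : IsHomog 0 (1 : F[X][X]) := by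
  intro i j hij
  rcases i with _ | i
  · have : j ≠ 0 := by omega
    simp [coeff_one, this]
  · simp [coeff_one]

theorem IsHomog.add {d : ℕ} {P Q : F[X][X]} (hP : IsHomog d P) (hQ : IsHomog d Q) :
    IsHomog d (P + Q) := by
  intro i j hij
  simp [hP i j hij, hQ i j hij]

theorem IsHomog.X_mul {d : ℕ} {P : F[X][X]} (hP : IsHomog d P) : IsHomog (d + 1) (X * P) := by
  intro i j hij
  rcases i with _ | i
  · simp
  · rw [coeff_X_mul]
    exact hP _ _ (by omega)

theorem IsHomog.C_X_mul {d : ℕ} {P : F[X][X]} (hP : IsHomog d P) :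
    IsHomog (d + 1) (C X * P) := by
  intro i j hij
  rw [coeff_C_mul]
  rcases j with _ | j
  · simp
  · rw [coeff_X_mul]
    exact hP _ _ (by omega)

theorem IsHomog.C_X_pow_mul {d : ℕ} {P : F[X][X]} (hP : IsHomog d P) (n : ℕ) :
    IsHomog (d + n) (C (X ^ n) * P) := by
  induction n with
  | zero => simpa using hP
  | succ n ih =>
    have := ih.C_X_mul
    rwa [← mul_assoc, ← C_mul, ← pow_succ'] at this

theorem IsHomog.C_C_mul {d : ℕ} {P : F[X][X]} (hP : IsHomog d P) (c : F) :
    IsHomog d (C (C c) * P) := by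
  intro i j hij
  rw [coeff_C_mul, coeff_C_mul, hP i j hij, mul_zero]

theorem isHomog_C_X_pow (n : ℕ) : IsHomog n (C (X ^ n) : F[X][X]) := by
  simpa using isHomog_one.C_X_pow_mul (F := F) n

theorem isHomog_X_add_C_X_pow (n : ℕ) : IsHomog n ((X + C X : F[X][X]) ^ n) := by
  induction n with
  | zero => simpa using isHomog_one
  | succ n ih =>
    rw [pow_succ', add_mul]
    exact ih.X_mul.add ih.C_X_mul

/-- A common divisor of a power of `x` and a power of `y + x` is a unit. -/
theorem isUnit_of_dvd_pow {P : F[X][X]} {r s : ℕ} (h₁ : P ∣ C (X ^ r))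
    (h₂ : P ∣ (X + C X) ^ s) : IsUnit P := by
  have hp : Prime (C X : F[X][X]) := prime_C_iff.2 prime_X
  rw [C_pow, dvd_prime_pow hp] at h₁
  obtain ⟨i, -, hi⟩ := h₁
  rcases i with _ | i
  · rw [pow_zero] at hi
    exact associated_one_iff_isUnit.1 hi
  · exfalso
    have h3 : (C X : F[X][X]) ∣ (X + C X) ^ s :=
      ((dvd_pow_self _ i.succ_ne_zero).trans hi.symm.dvd).trans h₂
    have h4 := hp.dvd_of_dvd_pow h3
    have h5 : (C X : F[X][X]) ∣ X := (dvd_add_left dvd_rfl).1 h4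
    rw [C_dvd_iff_dvd_coeff] at h5
    have := h5 1
    rw [coeff_X_one] at this
    exact not_isUnit_X (isUnit_of_dvd_one this)

/-- If one of two homogeneous generators is divisible by `y`, the quotient is homogeneous of degree
one less. -/
theorem exists_generators_of_coeff_eq_zero {I : Ideal F[X][X]} {P Q : F[X][X]} {a b m r s : ℕ}
    (hI : I = Ideal.span {P, Q}) (hP : IsHomog a P) (hQ : IsHomog b Q) (hab : a + b = m + 1)
    (hr : C (X ^ r) ∈ I) (hs : (X + C X) ^ s ∈ I)
    (hβ : (Q.coeff 0).coeff b = 0) :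
    ∃ (b' : ℕ) (Q' : F[X][X]), a + b' = m ∧ IsHomog b' Q' ∧ I = Ideal.span {P, X * Q'} := by
  have hQ0 : X * Q.divX = Q := by
    have h0 : Q.coeff 0 = 0 := by rw [hQ.coeff_zero, hβ]; simp
    have := X_mul_divX_add Q
    rwa [h0, C_0, add_zero] at this
  rcases b with _ | b
  -- For b = 0 the generator Q vanishes, so P alone generates I and must be a unit, although its
  -- degree a = m + 1 is positive.
  · have hQz : Q = 0 := by
      ext i j
      by_cases hij : i + j = 0
      · obtain ⟨rfl, rfl⟩ : i = 0 ∧ j = 0 := by omega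
        simpa using hβ
      · simpa using hQ i j hij
    subst hQz
    have hI' : I = Ideal.span {P} := by rw [hI, Ideal.span_pair_zero]
    rw [hI', Ideal.mem_span_singleton] at hr hs
    have hu := isUnit_of_dvd_pow hr hs
    exfalso
    have h1 : IsUnit (P.coeff 0) := by
      rw [coeff_zero_eq_eval_zero, ← coe_evalRingHom]
      exact hu.map _
    rw [hP.coeff_zero] at h1
    have h2 : IsUnit ((X : F[X]) ^ a) := isUnit_of_mul_isUnit_right h1
    rw [isUnit_pow_iff (by omega)] at h2
    exact not_isUnit_X h2
  · exact ⟨b, Q.divX, by omega, hQ.divX, by rw [hQ0, hI]⟩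

/-- At y = 0, homogeneous P and Q become scalar multiples of x^a and x^b, the first one nonzero.
Hence Q minus a suitable scalar multiple of x^(b-a) P is divisible by y. -/
theorem exists_generators_of_le {I : Ideal F[X][X]} {P Q : F[X][X]} {a b m r s : ℕ}
    (hI : I = Ideal.span {P, Q}) (hP : IsHomog a P) (hQ : IsHomog b Q) (hab : a + b = m + 1)
    (hr : C (X ^ r) ∈ I) (hs : (X + C X) ^ s ∈ I)
    (hα : (P.coeff 0).coeff a ≠ 0) (hle : a ≤ b) :
    ∃ (b' : ℕ) (Q' : F[X][X]), a + b' = m ∧ IsHomog b' Q' ∧ I = Ideal.span {P, X * Q'} := by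
  set c : F := -((Q.coeff 0).coeff b / (P.coeff 0).coeff a) with hc
  have hR : IsHomog b (C (C c) * (C (X ^ (b - a)) * P)) := by
    have := (hP.C_X_pow_mul (b - a)).C_C_mul c
    rwa [Nat.add_sub_cancel' hle] at this
  refine exists_generators_of_coeff_eq_zero (Q := Q + C (C c) * (C (X ^ (b - a)) * P))
    ?_ hP (hQ.add hR) hab hr hs ?_
  · rw [hI, ← mul_assoc, Ideal.span_pair_add_mul_left]
  · rw [coeff_add, coeff_C_mul, coeff_C_mul, coeff_add, coeff_C_mul, coeff_X_pow_mul', if_pos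
      (Nat.sub_le _ _), Nat.sub_sub_self hle, hc]
    field_simp
    ring

/-- An ideal generated by homogeneous polynomials of degrees `a` and `b` which contains powers of
`x` and of `y + x` is also generated by homogeneous polynomials of the same degrees one of which is
divisible by `y` while the other one is not. -/
theorem exists_generators {I : Ideal F[X][X]} {P Q : F[X][X]} {a b m r s : ℕ}
    (hI : I = Ideal.span {P, Q}) (hP : IsHomog a P) (hQ : IsHomog b Q) (hab : a + b = m + 1)
    (hr : C (X ^ r) ∈ I) (hs : (X + C X) ^ s ∈ I) :
    ∃ (a' b' : ℕ) (P' Q' : F[X][X]), (a' = a ∨ a' = b) ∧ a' + b' = m ∧ IsHomog a' P' ∧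
      IsHomog b' Q' ∧ I = Ideal.span {P', X * Q'} ∧ (P'.coeff 0).coeff a' ≠ 0 := by
  have hI' : I = Ideal.span {Q, P} := by rw [hI, Ideal.span_pair_comm]
  by_cases hα : (P.coeff 0).coeff a = 0
  · by_cases hβ : (Q.coeff 0).coeff b = 0
    -- If y divided both generators, it would divide x^r.
    · exfalso
      have h1 : I ≤ Ideal.span {X} := by
        rw [hI, Ideal.span_le]
        rintro f (rfl | rfl)
        · rw [SetLike.mem_coe, Ideal.mem_span_singleton, X_dvd_iff, hP.coeff_zero, hα]
          simp
        · rw [SetLike.mem_coe, Ideal.mem_span_singleton, X_dvd_iff, hQ.coeff_zero, hβ]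
          simp
      have h2 := h1 hr
      rw [Ideal.mem_span_singleton, X_dvd_iff, coeff_C_zero] at h2
      exact pow_ne_zero r X_ne_zero h2
    · obtain ⟨b', Q', h1, h2, h3⟩ :=
        exists_generators_of_coeff_eq_zero (m := m) hI' hQ hP (by omega) hr hs hα
      exact ⟨b, b', Q, Q', Or.inr rfl, h1, hQ, h2, h3, hβ⟩
  · by_cases hβ : (Q.coeff 0).coeff b = 0
    · obtain ⟨b', Q', h1, h2, h3⟩ := exists_generators_of_coeff_eq_zero hI hP hQ hab hr hs hβ
      exact ⟨a, b', P, Q', Or.inl rfl, h1, hP, h2, h3, hα⟩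
    · rcases le_total a b with hle | hle
      · obtain ⟨b', Q', h1, h2, h3⟩ := exists_generators_of_le hI hP hQ hab hr hs hα hle
        exact ⟨a, b', P, Q', Or.inl rfl, h1, hP, h2, h3, hα⟩
      · obtain ⟨b', Q', h1, h2, h3⟩ :=
          exists_generators_of_le (m := m) hI' hQ hP (by omega) hr hs hβ hle
        exact ⟨b, b', Q, Q', Or.inr rfl, h1, hQ, h2, h3, hβ⟩

/-- Setting y = 0 in uP + vyQ = yf forces y to divide u, since P does not vanish at y = 0.
Cancelling y identifies the colon ideal of (P, yQ) by y as (P, Q). -/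
theorem X_mul_mem_span_iff {P Q f : F[X][X]} (hP : P.coeff 0 ≠ 0) :
    X * f ∈ Ideal.span {P, X * Q} ↔ f ∈ Ideal.span {P, Q} := by
  rw [Ideal.mem_span_pair, Ideal.mem_span_pair]
  constructor
  · rintro ⟨u, v, h⟩
    have h1 : u.coeff 0 = 0 := by
      have := congrArg (fun q => coeff q 0) h
      simpa [mul_coeff_zero, hP] using this
    obtain ⟨u', rfl⟩ := X_dvd_iff.2 h1
    refine ⟨u', v, mul_left_cancel₀ (X_ne_zero (R := F[X])) ?_⟩
    rw [← h]
    ring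
  · rintro ⟨u, v, rfl⟩
    exact ⟨X * u, v, by ring⟩

/-- Modulo y, the ideal (P, yQ) is generated by a nonzero scalar multiple of x^a, so F[x, y]/(P, yQ,
y) is F[x]/(x^a). -/
theorem exists_C_sub_X_mul_mem_iff {P Q : F[X][X]} {a : ℕ} (hP : IsHomog a P)
    (hα : (P.coeff 0).coeff a ≠ 0) (q : F[X]) :
    (∃ h, C q - X * h ∈ Ideal.span {P, X * Q}) ↔ q ∈ Ideal.span {X ^ a} := by
  rw [Ideal.mem_span_singleton]
  constructor
  · rintro ⟨h, hh⟩
    obtain ⟨u, v, e⟩ := Ideal.mem_span_pair.1 hh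
    have := congrArg (fun q => coeff q 0) e
    simp only [coeff_add, mul_coeff_zero, coeff_sub, coeff_X_zero, zero_mul, mul_zero, add_zero,
      coeff_C_zero, sub_zero] at this
    rw [← this, hP.coeff_zero]
    exact ((dvd_refl _).mul_left _).mul_left _
  · rintro ⟨t, rfl⟩
    set α := (P.coeff 0).coeff a with hαd
    refine ⟨-(C (C α⁻¹ * t) * P.divX), Ideal.mem_span_pair.2 ⟨C (C α⁻¹ * t), 0, ?_⟩⟩
    conv_lhs => rw [← X_mul_divX_add P, hP.coeff_zero, ← hαd]
    have : (C (X ^ a * t) : F[X][X]) = C (C α⁻¹ * t) * C (C α * X ^ a) := by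
      rw [← C_mul]
      congr 1
      have : (C α⁻¹ * C α : F[X]) = 1 := by rw [← C_mul, inv_mul_cancel₀ hα, C_1]
      linear_combination -(X ^ a * t) * this
    rw [this]
    ring

end Homogeneous

/-! ### Rank drops of the powers of L, read off from colon ideals. -/

section Ranks

variable {F : Type*} [Field F] {W : Type*} [AddCommGroup W] [Module F W]

theorem finrank_range_of_ker_eq_span (θ : F[X] →ₗ[F] W) (a : ℕ)
    (h : ∀ q, θ q = 0 ↔ q ∈ Ideal.span {(X : F[X]) ^ a}) :
    Module.finrank F (LinearMap.range θ) = a := by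
  have hk : LinearMap.ker θ = (Ideal.span {(X : F[X]) ^ a}).restrictScalars F := by
    ext q
    exact h q
  have e := (Submodule.quotEquivOfEq _ _ hk).symm.trans θ.quotKerEquivRange
  have e' := Submodule.Quotient.restrictScalarsEquiv F (Ideal.span {(X : F[X]) ^ a})
  rw [← (e'.symm.trans e).finrank_eq, finrank_quotient_span_eq_natDegree, natDegree_X_pow]

/-- The range of Φ is F[x, y]/(P, yQ) with L acting as y; its quotient by the image of y is
F[x]/(x^a), of dimension a. -/
theorem finrank_range_eq_add [FiniteDimensional F W] (Φ : F[X][X] →ₗ[F] W) (L : W →ₗ[F] W)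
    (hL : ∀ f, Φ (X * f) = L (Φ f)) {P Q : F[X][X]} {a : ℕ}
    (hΦ : ∀ f, Φ f = 0 ↔ f ∈ Ideal.span {P, X * Q}) (hP : IsHomog a P)
    (hα : (P.coeff 0).coeff a ≠ 0) :
    Module.finrank F (LinearMap.range Φ) = Module.finrank F (LinearMap.range (L ∘ₗ Φ)) + a := by
  set U := LinearMap.range (L ∘ₗ Φ) with hU
  have hUle : U ≤ LinearMap.range Φ := by
    rintro _ ⟨f, rfl⟩
    exact ⟨X * f, hL f⟩
  set θ : F[X] →ₗ[F] (W ⧸ U) := U.mkQ ∘ₗ Φ ∘ₗ (CAlgHom (R := F) (A := F[X])).toLinearMap with hθ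
  have hθ0 : ∀ q, θ q = 0 ↔ q ∈ Ideal.span {(X : F[X]) ^ a} := by
    intro q
    rw [← exists_C_sub_X_mul_mem_iff (Q := Q) hP hα]
    simp only [hθ, LinearMap.comp_apply, Submodule.mkQ_apply, Submodule.Quotient.mk_eq_zero]
    change Φ (C q) ∈ U ↔ _
    simp only [← hΦ, map_sub, hL, sub_eq_zero]
    exact ⟨fun ⟨h, e⟩ => ⟨h, e.symm⟩, fun ⟨h, e⟩ => ⟨h, e.symm⟩⟩
  set π : LinearMap.range Φ →ₗ[F] (W ⧸ U) := U.mkQ ∘ₗ (LinearMap.range Φ).subtype with hπ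
  have hr : LinearMap.range π = LinearMap.range θ := by
    apply le_antisymm
    · rintro _ ⟨⟨_, f, rfl⟩, rfl⟩
      refine ⟨f.coeff 0, ?_⟩
      change U.mkQ (Φ (C (f.coeff 0))) = U.mkQ (Φ f)
      rw [← sub_eq_zero, ← map_sub, Submodule.mkQ_apply, Submodule.Quotient.mk_eq_zero, ← map_sub]
      refine ⟨-f.divX, ?_⟩
      rw [LinearMap.comp_apply, ← hL]
      congr 1
      linear_combination -X_mul_divX_add f
    · rintro _ ⟨q, rfl⟩
      exact ⟨⟨Φ (C q), C q, rfl⟩, rfl⟩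
  have hk : Module.finrank F (LinearMap.ker π) = Module.finrank F U := by
    have : LinearMap.ker π = U.comap (LinearMap.range Φ).subtype := by
      rw [hπ, LinearMap.ker_comp, Submodule.ker_mkQ]
    rw [this]
    exact (Submodule.comapSubtypeEquivOfLe hUle).finrank_eq
  have := LinearMap.finrank_range_add_finrank_ker π
  rw [hr, hk, finrank_range_of_ker_eq_span θ a hθ0] at this
  omega

variable [FiniteDimensional F W] {Φ : F[X][X] →ₗ[F] W} {L : Module.End F W} {r s : ℕ}

/-- By `hk`, the ideal (P, Q) is (I : y^k). The degree a' of the new generator prime to y is also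
the rank drop, and it is inherited from the old pair of degrees: this limits the next drop to two
values. -/
theorem colon_step (hΦ : Function.Surjective Φ) (hL : ∀ f, Φ (X * f) = L (Φ f))
    (hker : ∀ f, Φ f = 0 ↔ f ∈ Ideal.span {C (X ^ r), (X + C X) ^ s}) {k m a b : ℕ}
    {P Q : F[X][X]} (hP : IsHomog a P) (hQ : IsHomog b Q) (hab : a + b = m + 1)
    (hk : ∀ f, (L ^ k) (Φ f) = 0 ↔ f ∈ Ideal.span {P, Q}) :
    ∃ (a' b' : ℕ) (P' Q' : F[X][X]), (a' = a ∨ a' = b) ∧ a' + b' = m ∧ IsHomog a' P' ∧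
      IsHomog b' Q' ∧ (∀ f, (L ^ (k + 1)) (Φ f) = 0 ↔ f ∈ Ideal.span {P', Q'}) ∧
      Module.finrank F (LinearMap.range (L ^ k)) =
        Module.finrank F (LinearMap.range (L ^ (k + 1))) + a' := by
  have hr : C (X ^ r) ∈ Ideal.span {P, Q} := by
    rw [← hk, (hker _).2 (Ideal.subset_span (by simp)), map_zero]
  have hs : (X + C X) ^ s ∈ Ideal.span {P, Q} := by
    rw [← hk, (hker _).2 (Ideal.subset_span (by simp)), map_zero]
  obtain ⟨a', b', P', Q', h1, h2, h3, h4, h5, h6⟩ := exists_generators rfl hP hQ hab hr hs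
  have hLk : ∀ f, ((L ^ k) ∘ₗ Φ) (X * f) = L (((L ^ k) ∘ₗ Φ) f) := by
    intro f
    rw [LinearMap.comp_apply, LinearMap.comp_apply, hL, ← Module.End.mul_apply,
      ← Module.End.mul_apply, pow_mul_comm']
  refine ⟨a', b', P', Q', h1, h2, h3, h4, fun f => ?_, ?_⟩
  · have hP0 : P'.coeff 0 ≠ 0 := fun h => h6 (by rw [h, coeff_zero])
    rw [← X_mul_mem_span_iff hP0, ← h5, ← hk, hL, pow_succ, Module.End.mul_apply]
  · have := finrank_range_eq_add ((L ^ k) ∘ₗ Φ) L hLk (P := P') (Q := Q')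
      (fun f => by rw [← h5, ← hk]; rfl) h3 h6
    have e : L ∘ₗ ((L ^ k) ∘ₗ Φ) = (L ^ (k + 1)) ∘ₗ Φ := by
      rw [← LinearMap.comp_assoc, pow_succ']; rfl
    rwa [e, LinearMap.range_comp_of_range_eq_top _ (LinearMap.range_eq_top.2 hΦ),
      LinearMap.range_comp_of_range_eq_top _ (LinearMap.range_eq_top.2 hΦ)] at this

/-- Iterates `colon_step`, keeping the latest rank drop as the first degree a. The last clause is
vacuous at k = 0, where no drop has occurred yet. -/
theorem exists_colon_generators (hΦ : Function.Surjective Φ) (hL : ∀ f, Φ (X * f) = L (Φ f))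
    (hker : ∀ f, Φ f = 0 ↔ f ∈ Ideal.span {C (X ^ r), (X + C X) ^ s}) (k : ℕ)
    (hk : k ≤ r + s) :
    ∃ (a b : ℕ) (P Q : F[X][X]), a + b + k = r + s ∧ IsHomog a P ∧ IsHomog b Q ∧
      (∀ f, (L ^ k) (Φ f) = 0 ↔ f ∈ Ideal.span {P, Q}) ∧
      ∀ j, k = j + 1 → Module.finrank F (LinearMap.range (L ^ j)) =
        Module.finrank F (LinearMap.range (L ^ k)) + a := by
  induction k with
  | zero =>
    exact ⟨r, s, _, _, rfl, isHomog_C_X_pow r, isHomog_X_add_C_X_pow s, by simpa using hker,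
      by simp⟩
  | succ k ih =>
    obtain ⟨a, b, P, Q, hab, hP, hQ, h, -⟩ := ih (by omega)
    obtain ⟨a', b', P', Q', h1, h2, h3, h4, h5, h6⟩ :=
      colon_step hΦ hL hker (m := r + s - k - 1) hP hQ (by omega) h
    refine ⟨a', b', P', Q', by omega, h3, h4, h5, ?_⟩
    rintro j hj
    obtain rfl : k = j := by omega
    exact h6

/-- Consecutive rank drops of the powers of `L` are either equal or add up to `r + s - k`. -/
theorem finrank_drop_eq_or_add_eq (hΦ : Function.Surjective Φ) (hL : ∀ f, Φ (X * f) = L (Φ f))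
    (hker : ∀ f, Φ f = 0 ↔ f ∈ Ideal.span {C (X ^ r), (X + C X) ^ s}) {g : ℕ → ℕ}
    (hg : ∀ k, Module.finrank F (LinearMap.range (L ^ k)) =
      Module.finrank F (LinearMap.range (L ^ (k + 1))) + g (k + 1)) (hg' : Antitone g) (hr : 1 ≤ r)
    (k : ℕ) (hk : 1 ≤ k) :
    g k = g (k + 1) ∨ g k + g (k + 1) + k = r + s := by
  rcases lt_or_ge k (r + s) with hlt | hge
  · obtain ⟨j, rfl⟩ : ∃ j, k = j + 1 := ⟨k - 1, by omega⟩
    obtain ⟨a, b, P, Q, hab, hP, hQ, h, h'⟩ :=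
      exists_colon_generators hΦ hL hker (j + 1) hlt.le
    have h1 := h' j rfl
    obtain ⟨a', b', P', Q', h1', h2, h3, h4, h5, h6⟩ :=
      colon_step hΦ hL hker (m := r + s - (j + 1) - 1) hP hQ (by omega) h
    have h7 := hg j
    have h8 := hg (j + 1)
    omega
  -- At k = r + s both degrees are 0, so the drop there is 0, and by monotonicity all later drops
  -- vanish too.
  · obtain ⟨j, hj⟩ : ∃ j, r + s = j + 1 := ⟨r + s - 1, by omega⟩
    obtain ⟨a, b, -, -, hab, -, -, -, h⟩ := exists_colon_generators hΦ hL hker (r + s) le_rfl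
    have h1 := h j hj
    have h2 := hg j
    rw [← hj] at h2
    have h3 : g k ≤ g (r + s) := hg' hge
    have h4 : g (k + 1) ≤ g (r + s) := hg' (hge.trans k.le_succ)
    have h5 : g (r + s) = a := Nat.add_left_cancel (h2.symm.trans h1)
    omega

end Ranks

/-! ### Indecomposable nilpotent operators are single Jordan blocks. -/

section Cyclic

variable {F : Type*} [Field F] {V : Type*} [AddCommGroup V] [Module F V]

/-- A nonzero finite-dimensional space with a nilpotent endomorphism that admits no nontrivial
invariant decomposition is isomorphic to `F[X] / (X ^ d)`. -/
theorem exists_cyclic_of_indecomposable [FiniteDimensional F V] [Nontrivial V] (T : Module.End F V)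
    (hT : IsNilpotent T)
    (hind : ∀ W₁ W₂ : Submodule F V, (∀ v ∈ W₁, T v ∈ W₁) → (∀ v ∈ W₂, T v ∈ W₂) →
      IsCompl W₁ W₂ → W₁ = ⊥ ∨ W₂ = ⊥) :
    ∃ φ : F[X] →ₗ[F] V, Function.Surjective φ ∧ (∀ q, φ (X * q) = T (φ q)) ∧
      ∀ q, φ q = 0 ↔ q ∈ Ideal.span {(X : F[X]) ^ Module.finrank F V} := by
  obtain ⟨e, he⟩ : ∃ e, nilpotencyClass T = e + 1 :=
    Nat.exists_eq_succ_of_ne_zero (pos_nilpotencyClass_iff.2 hT).ne'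
  have hTe : T ^ (e + 1) = 0 := by rw [← he]; exact pow_nilpotencyClass hT
  have hTe' : T ^ e ≠ 0 := by
    have := pow_pred_nilpotencyClass hT
    rwa [he, Nat.add_sub_cancel] at this
  obtain ⟨v, hv⟩ : ∃ v, (T ^ e) v ≠ 0 := by
    by_contra! h
    exact hTe' (LinearMap.ext h)
  obtain ⟨ψ, hψ⟩ := Module.Projective.exists_dual_ne_zero F hv
  set φ : F[X] →ₗ[F] V := LinearMap.applyₗ v ∘ₗ (aeval T).toLinearMap with hφ
  have hφa : ∀ q, φ q = (aeval T q) v := fun q => rfl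
  have hφX : ∀ k q, φ (X ^ k * q) = (T ^ k) (φ q) := by
    intro k q
    rw [hφa, hφa, map_mul, map_pow, aeval_X, Module.End.mul_apply]
  have hφX1 : ∀ q, φ (X * q) = T (φ q) := by
    intro q
    simpa using hφX 1 q
  -- If X^j is the exact power of X dividing q, then T^(e-j) sends φ q to a nonzero multiple of T^e
  -- v, which ψ detects.
  have key : ∀ q, ¬ X ^ (e + 1) ∣ q → ∃ i < e + 1, ψ ((T ^ i) (φ q)) ≠ 0 := by
    intro q hq
    rw [X_pow_dvd_iff] at hq
    push Not at hq
    obtain ⟨j, hj, hmin⟩ : ∃ j, (j < e + 1 ∧ q.coeff j ≠ 0) ∧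
        ∀ m < j, ¬ (m < e + 1 ∧ q.coeff m ≠ 0) := by
      classical
      exact ⟨Nat.find hq, Nat.find_spec hq, fun m => Nat.find_min hq⟩
    have hdvd : X ^ j ∣ q := by
      rw [X_pow_dvd_iff]
      intro m hm
      by_contra h
      exact hmin m hm ⟨hm.trans hj.1, h⟩
    obtain ⟨q, rfl⟩ := hdvd
    refine ⟨e - j, by omega, ?_⟩
    have h1 : q.coeff 0 ≠ 0 := by
      have := hj.2
      rwa [coeff_X_pow_mul', if_pos le_rfl, Nat.sub_self] at this
    rw [hφX, ← Module.End.mul_apply, ← pow_add, Nat.sub_add_cancel (by omega), ← hφX,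
      ← X_mul_divX_add q, mul_add, ← mul_assoc, ← pow_succ, map_add, hφX, hTe, hφX, hφa (C _),
      aeval_C, LinearMap.zero_apply, zero_add, Module.algebraMap_end_apply, map_smul, map_smul,
      smul_eq_mul]
    exact mul_ne_zero h1 hψ
  have hker : ∀ q, φ q = 0 ↔ q ∈ Ideal.span {(X : F[X]) ^ (e + 1)} := by
    intro q
    rw [Ideal.mem_span_singleton]
    constructor
    · intro h
      by_contra hq
      obtain ⟨i, -, hi⟩ := key q hq
      exact hi (by rw [h, map_zero, map_zero])
    · rintro ⟨q, rfl⟩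
      rw [hφX, hTe, LinearMap.zero_apply]
  have hrank := finrank_range_of_ker_eq_span φ (e + 1) hker
  -- The kernel of δ is the largest T-invariant subspace of ker ψ. It meets the cyclic subspace
  -- trivially by `key` and has codimension at most e + 1, so it is an invariant complement.
  set δ : V →ₗ[F] (Fin (e + 1) → F) := LinearMap.pi fun i => ψ ∘ₗ (T ^ (i : ℕ)) with hδ
  have hδ0 : ∀ u, u ∈ LinearMap.ker δ ↔ ∀ i < e + 1, ψ ((T ^ i) u) = 0 := by
    intro u
    rw [LinearMap.mem_ker, funext_iff]
    exact ⟨fun h i hi => h ⟨i, hi⟩, fun h i => h i i.2⟩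
  have hdisj : Disjoint (LinearMap.range φ) (LinearMap.ker δ) := by
    rw [Submodule.disjoint_def]
    rintro _ ⟨q, rfl⟩ hu
    rw [hδ0] at hu
    by_contra h
    rw [hker, Ideal.mem_span_singleton] at h
    obtain ⟨i, hi, hne⟩ := key q h
    exact hne (hu i hi)
  have hδrank := LinearMap.finrank_range_add_finrank_ker δ
  have hδle : Module.finrank F (LinearMap.range δ) ≤ e + 1 := by
    simpa using (LinearMap.range δ).finrank_le
  have hcompl : IsCompl (LinearMap.range φ) (LinearMap.ker δ) := by
    refine ⟨hdisj, codisjoint_iff.2 (Submodule.eq_top_of_finrank_eq (le_antisymm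
      (Submodule.finrank_le _) ?_))⟩
    have := Submodule.finrank_sup_add_finrank_inf_eq (LinearMap.range φ) (LinearMap.ker δ)
    rw [hdisj.eq_bot, finrank_bot] at this
    omega
  have hinv₁ : ∀ u ∈ LinearMap.range φ, T u ∈ LinearMap.range φ := by
    rintro _ ⟨q, rfl⟩
    exact ⟨X * q, hφX1 q⟩
  have hinv₂ : ∀ u ∈ LinearMap.ker δ, T u ∈ LinearMap.ker δ := by
    intro u hu
    rw [hδ0] at hu ⊢
    intro i hi
    rw [← Module.End.mul_apply, ← pow_succ]
    rcases Nat.lt_or_ge (i + 1) (e + 1) with h | h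
    · exact hu _ h
    · obtain rfl : i = e := by omega
      rw [hTe, LinearMap.zero_apply, map_zero]
  have hsurj : Function.Surjective φ := by
    rw [← LinearMap.range_eq_top]
    rcases hind _ _ hinv₁ hinv₂ hcompl with h | h
    · rw [h, finrank_bot] at hrank
      omega
    · rw [← hcompl.sup_eq_top, h, sup_bot_eq]
  refine ⟨φ, hsurj, hφX1, ?_⟩
  rwa [← finrank_top F V, ← LinearMap.range_eq_top.2 hsurj, hrank]

theorem finrank_range_pow_of_cyclic {φ : F[X] →ₗ[F] V} {T : Module.End F V} {d : ℕ}
    (hφ : Function.Surjective φ) (hT : ∀ q, φ (X * q) = T (φ q))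
    (hker : ∀ q, φ q = 0 ↔ q ∈ Ideal.span {(X : F[X]) ^ d}) (k : ℕ) :
    Module.finrank F (LinearMap.range (T ^ k)) = d - k := by
  have hTk : ∀ k q, φ (X ^ k * q) = (T ^ k) (φ q) := by
    intro k
    induction k with
    | zero => simp
    | succ k ih => intro q; rw [pow_succ, mul_assoc, ih, hT, pow_succ, Module.End.mul_apply]
  rw [← LinearMap.range_comp_of_range_eq_top (T ^ k) (LinearMap.range_eq_top.2 hφ)]
  refine finrank_range_of_ker_eq_span _ _ fun q => ?_
  rw [LinearMap.comp_apply, ← hTk, hker, Ideal.mem_span_singleton, Ideal.mem_span_singleton]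
  rcases le_total k d with h | h
  · conv_lhs => rw [← Nat.add_sub_cancel' h, pow_add]
    exact mul_dvd_mul_iff_left (pow_ne_zero k X_ne_zero)
  · rw [Nat.sub_eq_zero_of_le h, pow_zero]
    exact iff_of_true ((pow_dvd_pow _ h).mul_right _) (one_dvd _)

theorem finrank_range_lmap {ι : Type*} [Fintype ι] {M : ι → Type*} [∀ i, AddCommGroup (M i)]
    [∀ i, Module F (M i)] [∀ i, FiniteDimensional F (M i)] (T : ∀ i, Module.End F (M i)) :
    Module.finrank F (LinearMap.range (DirectSum.lmap T)) =
      ∑ i, Module.finrank F (LinearMap.range (T i)) := by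
  classical
  have hinj : Function.Injective (DirectSum.lmap fun i => (LinearMap.range (T i)).subtype) := by
    rw [DirectSum.lmap_injective]
    exact fun i => Subtype.val_injective
  have hsurj : Function.Surjective (DirectSum.lmap fun i => (T i).rangeRestrict) := by
    rw [DirectSum.lmap_surjective]
    exact fun i => (T i).surjective_rangeRestrict
  have hcomp : DirectSum.lmap T = (DirectSum.lmap fun i => (LinearMap.range (T i)).subtype) ∘ₗ
      DirectSum.lmap fun i => (T i).rangeRestrict := by
    rw [← DirectSum.lmap_comp]
    rfl
  rw [hcomp, LinearMap.range_comp_of_range_eq_top _ (LinearMap.range_eq_top.2 hsurj),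
    LinearMap.finrank_range_of_inj hinj, Module.finrank_directSum]

theorem lmap_pow {ι : Type*} {M : ι → Type*} [∀ i, AddCommGroup (M i)]
    [∀ i, Module F (M i)] (T : ∀ i, Module.End F (M i)) (k : ℕ) :
    (DirectSum.lmap T : Module.End F (⨁ i, M i)) ^ k = DirectSum.lmap fun i => T i ^ k := by
  classical
  induction k with
  | zero => ext i x : 2; simp
  | succ k ih => rw [pow_succ, ih]; ext i x : 2; simp [pow_succ]

end Cyclic

/-! ### The tensor product of two cyclic modules as F[x, y]/(x^r, (y + x)^s). -/

section Tensor

variable {F : Type*} [Field F] {A B : Type*} [AddCommGroup A] [Module F A] [AddCommGroup B]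
  [Module F B]

theorem exists_tensor_presentation {φ : F[X] →ₗ[F] A} {ψ : F[X] →ₗ[F] B} {T : Module.End F A}
    {U : Module.End F B} {r s : ℕ}
    (hφ : Function.Surjective φ) (hT : ∀ q, φ (X * q) = T (φ q))
    (hkφ : ∀ q, φ q = 0 ↔ q ∈ Ideal.span {(X : F[X]) ^ r})
    (hψ : Function.Surjective ψ) (hU : ∀ q, ψ (X * q) = U (ψ q))
    (hkψ : ∀ q, ψ q = 0 ↔ q ∈ Ideal.span {(X : F[X]) ^ s}) :
    ∃ Φ : F[X][X] →ₗ[F] A ⊗[F] B, Function.Surjective Φ ∧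
      (∀ f, Φ (X * f) =
        (TensorProduct.map LinearMap.id U - TensorProduct.map T LinearMap.id :
          Module.End F (A ⊗[F] B)) (Φ f)) ∧
      ∀ f, Φ f = 0 ↔ f ∈ Ideal.span {C (X ^ r), (X + C X) ^ s} := by
  set Θ := TensorProduct.map φ ψ with hΘ
  have hx : ∀ z, Θ ((X ⊗ₜ 1) * z) = TensorProduct.map T LinearMap.id (Θ z) := by
    intro z
    induction z with
    | zero => simp
    | add x y hx hy => rw [mul_add, map_add, map_add, map_add, hx, hy]
    | tmul x y => simp [hΘ, hT]
  have hy : ∀ z, Θ ((1 ⊗ₜ X) * z) = TensorProduct.map LinearMap.id U (Θ z) := by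
    intro z
    induction z with
    | zero => simp
    | add x y hx hy => rw [mul_add, map_add, map_add, map_add, hx, hy]
    | tmul x y => simp [hΘ, hU]
  have hker : ∀ z, Θ z = 0 ↔
      z ∈ Ideal.span {((X : F[X]) ^ r) ⊗ₜ[F] (1 : F[X]), (1 : F[X]) ⊗ₜ[F] ((X : F[X]) ^ s)} := by
    have hle : ∀ z, z ∈ Ideal.span
        {((X : F[X]) ^ r) ⊗ₜ[F] (1 : F[X]), (1 : F[X]) ⊗ₜ[F] ((X : F[X]) ^ s)} → Θ z = 0 := by
      have h1 : ∀ z, Θ (((X : F[X]) ^ r) ⊗ₜ[F] (1 : F[X]) * z) = 0 := by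
        intro z
        induction z with
        | zero => simp
        | add x y hx hy => rw [mul_add, map_add, hx, hy, add_zero]
        | tmul x y =>
          rw [Algebra.TensorProduct.tmul_mul_tmul, hΘ, TensorProduct.map_tmul,
            (hkφ _).2 (Ideal.mem_span_singleton.2 (dvd_mul_right _ _)), zero_tmul]
      have h2 : ∀ z, Θ ((1 : F[X]) ⊗ₜ[F] ((X : F[X]) ^ s) * z) = 0 := by
        intro z
        induction z with
        | zero => simp
        | add x y hx hy => rw [mul_add, map_add, hx, hy, add_zero]
        | tmul x y =>
          rw [Algebra.TensorProduct.tmul_mul_tmul, hΘ, TensorProduct.map_tmul,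
            (hkψ _).2 (Ideal.mem_span_singleton.2 (dvd_mul_right _ _)), tmul_zero]
      intro z hz
      obtain ⟨u, v, rfl⟩ := Ideal.mem_span_pair.1 hz
      rw [map_add, mul_comm, h1, mul_comm, h2, add_zero]
    intro z
    refine ⟨fun hz => ?_, hle z⟩
    -- Right exactness: the kernel of φ ⊗ ψ is the sum of the images of F[X] ⊗ ker ψ and ker φ ⊗
    -- F[X].
    have hex := TensorProduct.map_ker (LinearMap.exact_subtype_ker_map φ) hφ
      (LinearMap.exact_subtype_ker_map ψ) hψ
    have hz' : z ∈ LinearMap.ker Θ := hz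
    rw [hΘ, hex, Submodule.mem_sup] at hz'
    obtain ⟨_, ⟨x, rfl⟩, _, ⟨y, rfl⟩, rfl⟩ := hz'
    refine Ideal.add_mem _ ?_ ?_
    · clear hz
      induction x with
      | zero => simp
      | add x y hx hy => rw [map_add]; exact Ideal.add_mem _ hx hy
      | tmul x y =>
        obtain ⟨y, hy⟩ := y
        obtain ⟨q, rfl⟩ := Ideal.mem_span_singleton.1 ((hkψ y).1 hy)
        have : (LinearMap.lTensor F[X] (LinearMap.ker ψ).subtype) (x ⊗ₜ ⟨X ^ s * q, hy⟩) =
          (x ⊗ₜ q) * ((1 : F[X]) ⊗ₜ[F] ((X : F[X]) ^ s)) := by simp [mul_comm]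
        rw [this]
        exact Ideal.mul_mem_left _ _ (Ideal.subset_span (by simp))
    · clear hz
      induction y with
      | zero => simp
      | add x y hx hy => rw [map_add]; exact Ideal.add_mem _ hx hy
      | tmul y x =>
        obtain ⟨y, hy⟩ := y
        obtain ⟨q, rfl⟩ := Ideal.mem_span_singleton.1 ((hkφ y).1 hy)
        have : (LinearMap.rTensor F[X] (LinearMap.ker φ).subtype) (⟨X ^ r * q, hy⟩ ⊗ₜ x) =
          (q ⊗ₜ x) * (((X : F[X]) ^ r) ⊗ₜ[F] (1 : F[X])) := by simp [mul_comm]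
        rw [this]
        exact Ideal.mul_mem_left _ _ (Ideal.subset_span (by simp))
  -- The Taylor shift by -x sends y to 1 ⊗ X - X ⊗ 1, so that y acts as the required difference of
  -- operators and y + x becomes 1 ⊗ X.
  set E : F[X][X] ≃ₐ[F] F[X] ⊗[F] F[X] :=
    ((taylorEquiv (-X : F[X])).restrictScalars F).trans (polyEquivTensor F F[X]) with hE
  have hEX : E X = 1 ⊗ₜ X - X ⊗ₜ 1 := by
    have : taylorEquiv (-X : F[X]) X = X - C X := by
      change taylor (-X : F[X]) X = _
      rw [taylor_X, C_neg, sub_eq_add_neg]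
    change polyEquivTensor F F[X] (taylorEquiv (-X : F[X]) X) = _
    rw [this, map_sub, polyEquivTensor_apply, polyEquivTensor_apply, eval₂_X, eval₂_C]
    rfl
  have hEC : ∀ q : F[X], E (C q) = q ⊗ₜ 1 := by
    intro q
    have : taylorEquiv (-X : F[X]) (C q) = C q := taylor_C _ _
    change polyEquivTensor F F[X] (taylorEquiv (-X : F[X]) (C q)) = _
    rw [this, polyEquivTensor_apply, eval₂_C]
    rfl
  have hEX' : E (X + C X) = 1 ⊗ₜ X := by
    rw [map_add, hEX, hEC, sub_add_cancel]
  have hmap : (Ideal.span {C (X ^ r), (X + C X) ^ s}).map E = Ideal.span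
      {((X : F[X]) ^ r) ⊗ₜ[F] (1 : F[X]), (1 : F[X]) ⊗ₜ[F] ((X : F[X]) ^ s)} := by
    rw [Ideal.map_span, Set.image_pair, hEC, map_pow, hEX', Algebra.TensorProduct.tmul_pow,
      one_pow]
  refine ⟨Θ ∘ₗ E.toLinearMap, ?_, fun f => ?_, fun f => ?_⟩
  · exact (TensorProduct.map_surjective hφ hψ).comp E.surjective
  · change Θ (E (X * f)) = (TensorProduct.map LinearMap.id U - TensorProduct.map T LinearMap.id :
          Module.End F (A ⊗[F] B)) (Θ (E f))
    rw [map_mul, hEX, sub_mul, map_sub, hx, hy, LinearMap.sub_apply]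
  · change Θ (E f) = 0 ↔ _
    rw [hker, ← hmap]
    refine ⟨fun h => ?_, Ideal.mem_map_of_mem E⟩
    obtain ⟨f', hf', he⟩ := (Ideal.mem_map_of_equiv E.toRingEquiv (E f)).1 h
    rwa [← E.injective he]

end Tensor

/-! ### From representations of the cyclic p-group to rank drops and parts. -/

section Representations

theorem finrank_range_comp_of_injective {F U V W : Type*} [Field F] [AddCommGroup U] [Module F U]
    [AddCommGroup V] [Module F V] [AddCommGroup W] [Module F W] (f : V →ₗ[F] W)
    (hf : Function.Injective f) (h : U →ₗ[F] V) :
    Module.finrank F (LinearMap.range (f ∘ₗ h)) = Module.finrank F (LinearMap.range h) := by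
  rw [LinearMap.range_comp]
  exact (Submodule.equivMapOfInjective f hf (LinearMap.range h)).finrank_eq.symm

theorem isNilpotent_rho_sub_one {F G V : Type*} [Field F] [Group G] [AddCommGroup V] [Module F V]
    (p : ℕ) [Fact p.Prime] [CharP F p] {n : ℕ} (hG : Nat.card G = p ^ n)
    (ρ : Representation F G V) (u : G) : IsNilpotent (ρ u - 1) := by
  refine ⟨p ^ n, ?_⟩
  have h1 : aeval (ρ u) (((X : F[X]) - 1) ^ p ^ n) =
      aeval (ρ u) ((X : F[X]) ^ p ^ n - 1 ^ p ^ n) := by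
    rw [sub_pow_char_pow]
  rw [map_pow, map_sub, aeval_X, map_one, one_pow, map_sub, map_pow, aeval_X, map_one,
    ← map_pow, ← hG, pow_card_eq_one', map_one, sub_self, hG] at h1
  exact h1

variable {F : Type u} {G : Type v} [Field F] [Group G]

theorem exists_cyclic_presentation (p : ℕ) [Fact p.Prime] [CharP F p] {n : ℕ}
    (hG : Nat.card G = p ^ n) {u : G} (hu : ∀ x, x ∈ Subgroup.zpowers u) {d : ℕ} (hd : 1 ≤ d)
    {V : Rep.{w} F G} (hV : IsIndecomposableOfDim d V) :
    ∃ φ : F[X] →ₗ[F] V, Function.Surjective φ ∧ (∀ q, φ (X * q) = (V.ρ u - 1) (φ q)) ∧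
      ∀ q, φ q = 0 ↔ q ∈ Ideal.span {(X : F[X]) ^ d} := by
  obtain ⟨⟨hnt, hind⟩, hdim⟩ := hV
  have hfd : FiniteDimensional F V := Module.finite_of_finrank_pos (by omega)
  have hfin : Finite G := Nat.finite_of_card_ne_zero (by
    rw [hG]; exact pow_ne_zero _ (Fact.out : p.Prime).ne_zero)
  rw [← hdim]
  refine exists_cyclic_of_indecomposable (V.ρ u - 1) (isNilpotent_rho_sub_one p hG V.ρ u) ?_
  -- As G is finite, every element is a nonnegative power of u, so invariance under u - 1 suffices.
  have hsub : ∀ W : Submodule F V, (∀ v ∈ W, (V.ρ u - 1) v ∈ W) →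
      ∀ g, ∀ v ∈ W, V.ρ g v ∈ W := by
    intro W hW g v hv
    obtain ⟨k, rfl⟩ := (mem_powers_iff_mem_zpowers.2 (hu g))
    induction k with
    | zero => simpa using hv
    | succ k ih =>
      have h1 := W.add_mem (hW _ ih) ih
      simpa [pow_succ'] using h1
  intro W₁ W₂ h₁ h₂ hc
  have := hind ⟨W₁, fun g v => hsub W₁ h₁ g v⟩ ⟨W₂, fun g v => hsub W₂ h₂ g v⟩
    ⟨disjoint_iff.2 (Subrepresentation.toSubmodule_injective hc.inf_eq_bot),
      codisjoint_iff.2 (Subrepresentation.toSubmodule_injective hc.sup_eq_top)⟩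
  exact this.imp (congrArg Subrepresentation.toSubmodule) (congrArg Subrepresentation.toSubmodule)

/-- The number of parts of size at least `k`, counted with multiplicities. -/
def numParts {t : ℕ} (m μ : Fin t → ℕ) (k : ℕ) : ℕ :=
  ∑ i, if k ≤ μ i then m i else 0

theorem numParts_antitone {t : ℕ} (m μ : Fin t → ℕ) : Antitone (numParts m μ) := by
  intro k l hkl
  refine Finset.sum_le_sum fun i _ => ?_
  split_ifs <;> omega

theorem numParts_apply {t : ℕ} {m μ : Fin t → ℕ} (hμ : StrictAnti μ) (i : Fin t) :
    numParts m μ (μ i) = ∑ j ∈ Finset.Iio i, m j + m i := by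
  have h : Finset.univ.filter (fun j => μ i ≤ μ j) = Finset.Iic i := by
    ext j
    simp [hμ.le_iff_ge]
  rw [numParts, ← Finset.sum_filter, h, ← Finset.Iio_insert, Finset.sum_insert (by simp), add_comm]

theorem numParts_apply_add_one {t : ℕ} {m μ : Fin t → ℕ} (hμ : StrictAnti μ) (i : Fin t) :
    numParts m μ (μ i + 1) = ∑ j ∈ Finset.Iio i, m j := by
  have h : Finset.univ.filter (fun j => μ i + 1 ≤ μ j) = Finset.Iio i := by
    ext j
    simp [hμ.lt_iff_gt]
  rw [numParts, ← Finset.sum_filter, h]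

/-- On a tensor product of representations, `g ⊗ g - 1` is the product of the automorphism `g ⊗ 1`
and the operator `1 ⊗ (g - 1) - (g⁻¹ - 1) ⊗ 1`, which commutes with it. -/
theorem finrank_range_tprod_sub_one_pow (A B : Rep.{w} F G) (g : G) (k : ℕ) :
    Module.finrank F (LinearMap.range (((A.ρ.tprod B.ρ) g - 1) ^ k)) =
      Module.finrank F (LinearMap.range ((TensorProduct.map LinearMap.id (B.ρ g - 1) -
        TensorProduct.map (A.ρ g⁻¹ - 1) LinearMap.id : Module.End F (A ⊗[F] B)) ^ k)) := by
  set L : Module.End F (A ⊗[F] B) := TensorProduct.map LinearMap.id (B.ρ g - 1) -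
        TensorProduct.map (A.ρ g⁻¹ - 1) LinearMap.id with hL
  set a : Module.End F (A ⊗[F] B) := TensorProduct.map (A.ρ g) LinearMap.id with ha
  set a' : Module.End F (A ⊗[F] B) := TensorProduct.map (A.ρ g⁻¹) LinearMap.id with ha'
  have h1 : (A.ρ.tprod B.ρ) g - 1 = a * L := by
    ext x y
    simp [hL, ha, tmul_sub, sub_tmul]
  have h2 : Commute a L := by
    refine TensorProduct.ext' fun x y => ?_
    simp [hL, ha, tmul_sub, sub_tmul]
  have h3 : Commute a' a := by
    refine TensorProduct.ext' fun x y => ?_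
    simp [ha, ha']
  have h4 : a' * a = 1 := by
    refine TensorProduct.ext' fun x y => ?_
    simp [ha, ha']
  rw [h1, h2.mul_pow]
  refine finrank_range_comp_of_injective (a ^ k) ?_ (L ^ k)
  refine Function.LeftInverse.injective (g := a' ^ k) fun x => ?_
  rw [← Module.End.mul_apply, ← h3.mul_pow, h4, one_pow, Module.End.one_apply]

theorem finrank_range_pow_equiv {V W : Type*} [AddCommGroup V] [Module F V] [AddCommGroup W]
    [Module F W] (e : V ≃ₗ[F] W) (S : Module.End F V) (T : Module.End F W)
    (h : ∀ v, e (S v) = T (e v)) (k : ℕ) :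
    Module.finrank F (LinearMap.range (S ^ k)) = Module.finrank F (LinearMap.range (T ^ k)) := by
  have hk : (e : V →ₗ[F] W) ∘ₗ (S ^ k) = (T ^ k) ∘ₗ (e : V →ₗ[F] W) := by
    ext v
    simp only [LinearMap.comp_apply, LinearEquiv.coe_coe]
    induction k generalizing v with
    | zero => simp
    | succ k ih => rw [pow_succ, pow_succ, Module.End.mul_apply, Module.End.mul_apply, ih, h]
  rw [← finrank_range_comp_of_injective (e : V →ₗ[F] W) e.injective, hk,
    LinearMap.range_comp_of_range_eq_top _ (LinearEquiv.range e)]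

/-- The number of parts of size at least `k` in a Green decomposition only drops at `k` if
`k` is `r + s` minus the sum of the numbers before and after the drop. -/
theorem numParts_eq_or_add_eq (p : ℕ) [Fact p.Prime] [CharP F p] [IsCyclic G] {n : ℕ}
    (hG : Nat.card G = p ^ n) {r s : ℕ} (hr : 1 ≤ r) (hs : 1 ≤ s) {t : ℕ} {m μ : Fin t → ℕ}
    (h : IsGreenDecomposition.{u, v, w} F G r s m μ) (k : ℕ) (hk : 1 ≤ k) :
    numParts m μ k = numParts m μ (k + 1) ∨
      numParts m μ k + numParts m μ (k + 1) + k = r + s := by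
  obtain ⟨g, hg⟩ := IsCyclic.exists_generator (α := G)
  -- The operator L involves g⁻¹ - 1 on the first factor, so that factor is presented through the
  -- generator g⁻¹.
  have hg' : ∀ x, x ∈ Subgroup.zpowers g⁻¹ := by simpa using hg
  obtain ⟨A, B, C, hA, hB, hC, ⟨e⟩⟩ := h.iso
  have hfA : FiniteDimensional F A := Module.finite_of_finrank_pos (by rw [hA.2]; exact hr)
  have hfB : FiniteDimensional F B := Module.finite_of_finrank_pos (by rw [hB.2]; exact hs)
  have hfC : ∀ i, FiniteDimensional F (C i) := fun i =>
    Module.finite_of_finrank_pos (by rw [(hC i).2]; exact h.part_pos i)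
  obtain ⟨φ, hφ, hφX, hφk⟩ := exists_cyclic_presentation p hG hg' hr hA
  obtain ⟨ψ, hψ, hψX, hψk⟩ := exists_cyclic_presentation p hG hg hs hB
  obtain ⟨Φ, hΦ, hΦX, hΦk⟩ := exists_tensor_presentation hφ hφX hφk hψ hψX hψk
  refine finrank_drop_eq_or_add_eq hΦ hΦX hΦk (fun k => ?_) (numParts_antitone m μ) hr k hk
  have hrank : ∀ k, Module.finrank F (LinearMap.range (((A.ρ.tprod B.ρ) g - 1) ^ k)) =
      ∑ i, m i * (μ i - k) := by
    intro k
    rw [finrank_range_pow_equiv e.toLinearEquiv _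
      (DirectSum.lmap fun x : (i : Fin t) × Fin (m i) => (C x.1).ρ g - 1) ?_ k, lmap_pow,
      finrank_range_lmap, Fintype.sum_sigma]
    · refine Finset.sum_congr rfl fun i _ => ?_
      obtain ⟨θ, hθ, hθX, hθk⟩ := exists_cyclic_presentation p hG hg (h.part_pos i) (hC i)
      simp [finrank_range_pow_of_cyclic hθ hθX hθk]
    · intro v
      have h1 : e.toLinearEquiv ((A.ρ.tprod B.ρ) g v) =
          (Representation.directSum fun x : (i : Fin t) × Fin (m i) => (C x.1).ρ) g
            (e.toLinearEquiv v) := e.toIntertwiningMap.isIntertwining _ _ g v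
      rw [LinearMap.sub_apply, map_sub, h1, Representation.directSum_apply]
      ext x
      simp
  rw [← finrank_range_tprod_sub_one_pow, ← finrank_range_tprod_sub_one_pow, hrank, hrank,
    numParts, ← Finset.sum_add_distrib]
  refine Finset.sum_congr rfl fun i _ => ?_
  split_ifs with hi
  · rw [show μ i - k = (μ i - (k + 1)) + 1 by omega, mul_add, mul_one]
  · rw [show μ i - k = 0 by omega, show μ i - (k + 1) = 0 by omega, add_zero]

/-- At k = μ_i the count of parts changes by m_i > 0, which rules out equality in the dichotomy. -/
theorem part_add_mult_add_two_mul_sum (p : ℕ) [Fact p.Prime] [CharP F p] [IsCyclic G] {n : ℕ}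
    (hG : Nat.card G = p ^ n) {r s : ℕ} (hr : 1 ≤ r) (hs : 1 ≤ s) {t : ℕ} {m μ : Fin t → ℕ}
    (h : IsGreenDecomposition.{u, v, w} F G r s m μ) (i : Fin t) :
    μ i + m i + 2 * ∑ j ∈ Finset.Iio i, m j = r + s := by
  have h1 := numParts_eq_or_add_eq p hG hr hs h (μ i) (h.part_pos i)
  rw [numParts_apply h.strictAnti, numParts_apply_add_one h.strictAnti] at h1
  have := h.mult_pos i
  omega

end Representations

/-! ### Inverting the formula for the parts. -/

section Arithmetic

theorem sum_Iio_succ {t : ℕ} {i j : Fin t} (h : (j : ℕ) = i + 1) (f : Fin t → ℤ) :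
    ∑ l ∈ Finset.Iio j, f l = ∑ l ∈ Finset.Iio i, f l + f i := by
  have : Finset.Iio j = insert i (Finset.Iio i) := by
    ext l
    simp only [Finset.mem_Iio, Finset.mem_insert, Fin.lt_def, Fin.ext_iff]
    omega
  rw [this, Finset.sum_insert (by simp), add_comm]

theorem sum_Iio_of_val_eq_zero {t : ℕ} {i : Fin t} (h : (i : ℕ) = 0) (f : Fin t → ℤ) :
    ∑ l ∈ Finset.Iio i, f l = 0 := by
  refine Finset.sum_eq_zero fun l hl => ?_
  have := Finset.mem_Iio.1 hl
  rw [Fin.lt_def] at this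
  omega

variable {t : ℕ} {m μ : Fin t → ℤ} {T : ℤ}

theorem mult_of_val_eq_succ (h : ∀ i, μ i = T - m i - 2 * ∑ j ∈ Finset.Iio i, m j) (i j : Fin t)
    (hij : (j : ℕ) = i + 1) : m j = μ i - μ j - m i := by
  rw [h i, h j, sum_Iio_succ hij]
  ring

theorem mult_eq_alternating_sum (h : ∀ i, μ i = T - m i - 2 * ∑ j ∈ Finset.Iio i, m j)
    (i : Fin t) :
    m i = (-1) ^ (i : ℕ) * (T + 2 * ∑ j ∈ Finset.Iio i, (-1) ^ ((j : ℕ) + 1) * μ j) - μ i := by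
  obtain ⟨k, hk⟩ := i
  induction k with
  | zero =>
    rw [sum_Iio_of_val_eq_zero rfl, h, sum_Iio_of_val_eq_zero rfl]
    ring
  | succ k ih =>
    have h1 := ih (by omega)
    have h2 := mult_of_val_eq_succ h ⟨k, by omega⟩ ⟨k + 1, hk⟩ rfl
    rw [sum_Iio_succ (i := ⟨k, by omega⟩) rfl]
    have h3 : ((-1 : ℤ) ^ k) * (-1) ^ k = 1 := by rw [← mul_pow]; simp
    rw [h2]
    simp only [pow_succ] at h1 ⊢
    linear_combination (-1 : ℤ) * h1 - 2 * μ ⟨k, by omega⟩ * h3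

end Arithmetic

end GreenRing

theorem theorem3 (p : ℕ) [Fact p.Prime] (F : Type u) [Field F] [CharP F p]
    (G : Type v) [Group G] [IsCyclic G] (n : ℕ) (hG : Nat.card G = p ^ n)
    (r s : ℕ) (hr : 1 ≤ r) (hs : 1 ≤ s) (t : ℕ) (m μ : Fin t → ℕ)
    (h : IsGreenDecomposition.{u, v, w} F G r s m μ) :
    -- the formula for the parts in terms of the multiplicities
    (∀ i : Fin t, (μ i : ℤ) = r + s - m i - 2 * ∑ j ∈ Finset.Iio i, (m j : ℤ)) ∧
    -- the formula for the multiplicities in terms of the parts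
    (∀ i : Fin t, (m i : ℤ) =
      (-1) ^ (i : ℕ) * (r + s + 2 * ∑ j ∈ Finset.Iio i, (-1) ^ ((j : ℕ) + 1) * (μ j : ℤ)) - μ i) ∧
    -- the recurrence conjectured by McFall
    (∀ i : Fin t, (i : ℕ) = 0 → (m i : ℤ) = r + s - μ i) ∧
    (∀ i j : Fin t, (j : ℕ) = i + 1 → (m j : ℤ) = μ i - μ j - m i) ∧
    -- for given `r`, `s`, multiplicities and parts determine each other, whatever the field is
    (∀ (p' : ℕ) [Fact p'.Prime] (F' : Type u') [Field F'] [CharP F' p']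
      (G' : Type v') [Group G'] [IsCyclic G'] (n' : ℕ), Nat.card G' = p' ^ n' →
      ∀ m' μ' : Fin t → ℕ, IsGreenDecomposition.{u', v', w'} F' G' r s m' μ' →
        (m = m' ↔ μ = μ')) := by
  have h1 : ∀ i : Fin t, (μ i : ℤ) = r + s - m i - 2 * ∑ j ∈ Finset.Iio i, (m j : ℤ) := by
    intro i
    have := GreenRing.part_add_mult_add_two_mul_sum p hG hr hs h i
    zify at this
    linarith
  refine ⟨h1, GreenRing.mult_eq_alternating_sum h1, fun i hi => ?_,
    GreenRing.mult_of_val_eq_succ h1, ?_⟩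
  · rw [h1, GreenRing.sum_Iio_of_val_eq_zero hi]
    ring
  -- Both formulas involve only r, s and the two sequences, so decompositions over different fields
  -- can be compared.
  · intro p' _ F' _ _ G' _ _ n' hG' m' μ' h'
    have h1' : ∀ i : Fin t, (μ' i : ℤ) = r + s - m' i - 2 * ∑ j ∈ Finset.Iio i, (m' j : ℤ) := by
      intro i
      have := GreenRing.part_add_mult_add_two_mul_sum p' hG' hr hs h' i
      zify at this
      linarith
    constructor
    · rintro rfl
      funext i
      exact_mod_cast (h1 i).trans (h1' i).symm
    · rintro rfl
      funext i
      exact_mod_cast (GreenRing.mult_eq_alternating_sum h1 i).trans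
        (GreenRing.mult_eq_alternating_sum h1' i).symm
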